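/- Let $p\ge 0$ be an integer, $V=\{1,\dots,p\}$, and let $\Omega^*$ be a symmetric positive definite real $p\times p$ matrix. Let $G^*$ be the conditional independence graph of $\boldsymbol x\sim N_p(\boldsymbol 0,(\Omega^*)^{-1})$: the undirected graph on $V$ (without loops) in which distinct nodes $i,j$ are non-adjacent if and only if $x_i$ and $x_j$ are conditionally independent given $(x_k)_{k\ne i,j}$. For each $n$ let $\boldsymbol X$ be an $n\times p$ data matrix whose rows are independent draws from $N_p(\boldsymbol 0,(\Omega^*)^{-1})$, and let $\boldsymbol S=\boldsymbol X^T\boldsymbol X$. For an undirected graph $G$ on $V$ and $j\in V$ let $mb(j)$ be the set of neighbours of $j$ in $G$, $fa(j)=mb(j)\cup\{j\}$, $p_j=|mb(j)|$, and define the fractional marginal pseudo-likelihood $$\hat p(\boldsymbol X\mid G)=\prod_{j=1}^p \pi^{-\frac{n-1}{2}}\,\frac{\Gamma\left(\frac{n+p_j}{2}\right)}{\Gamma\left(\frac{p_j+1}{2}\right)}\,n^{-\frac{2p_j+1}{2}}\left(\frac{|\boldsymbol S_{fa(j)}|}{|\boldsymbol S_{mb(j)}|}\right)^{-\frac{n-1}{2}},$$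 where $|\boldsymbol S_A|$ is the determinant of the submatrix of $\boldsymbol S$ with rows and columns in $A$ (and $|\boldsymbol S_\emptyset|=1$); for $n\ge p$ this is well defined with probability $1$. Let $\mathcal G$ be the set of all undirected graphs on $V$. Then, with probability tending to $1$ as $n\to\infty$, $G^*$ is the unique maximizer of $\hat p(\boldsymbol X\mid G)$ over $G\in\mathcal G$. Consequently every global fractional marginal pseudo-likelihood estimator $\widehat G\in\arg\max_{G\in\mathcal G}\hat p(\boldsymbol X\mid G)$ is consistent: $\widehat G=G^*$ with probability tending to $1$ as $n\to\infty$. -/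

import Mathlib

open MeasureTheory ProbabilityTheory Filter

open scoped Topology

noncomputable section

namespace FMPL

/-- The Markov blanket of the node `j` in the undirected graph `G`: the set of neighbours of `j`. -/
def markovBlanket {p : ℕ} (G : SimpleGraph (Fin p)) (j : Fin p) : Finset (Fin p) :=
  open Classical in Finset.univ.filter (fun i => G.Adj j i)

/-- The unscaled sample covariance matrix `S = Xᵀ X` of an `n × p` data matrix `X`
(each row is one observation). -/
def scatter {n p : ℕ} (X : Matrix (Fin n) (Fin p) ℝ) : Matrix (Fin p) (Fin p) ℝ :=
  X.transpose * X

/-- The determinant `|S_A|` of the submatrix of `S` restricted to the variables in `A`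
(equal to `1` if `A = ∅`). -/
def minor {p : ℕ} (S : Matrix (Fin p) (Fin p) ℝ) (A : Finset (Fin p)) : ℝ :=
  (S.submatrix (fun i : A => (i : Fin p)) (fun i : A => (i : Fin p))).det

/-- The local fractional marginal pseudo-likelihood `p(X_j ∣ X_mb)` of the node `j` with candidate
Markov blanket `mb` (a set of nodes not containing `j`); here `p_j = |mb|` and `fa = {j} ∪ mb`. -/
def localScore {n p : ℕ} (X : Matrix (Fin n) (Fin p) ℝ) (j : Fin p) (mb : Finset (Fin p)) : ℝ :=
  Real.pi ^ (-(((n : ℝ) - 1) / 2))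
    * (Real.Gamma (((n : ℝ) + (mb.card : ℝ)) / 2) / Real.Gamma (((mb.card : ℝ) + 1) / 2))
    * (n : ℝ) ^ (-((2 * (mb.card : ℝ) + 1) / 2))
    * (minor (scatter X) (insert j mb) / minor (scatter X) mb) ^ (-(((n : ℝ) - 1) / 2))

/-- The fractional marginal pseudo-likelihood of the graph `G`: the product over all nodes of the
local scores at the Markov blankets of `G`. -/
def score {n p : ℕ} (X : Matrix (Fin n) (Fin p) ℝ) (G : SimpleGraph (Fin p)) : ℝ :=
  ∏ j : Fin p, localScore X j (markovBlanket G j)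

/-- The set `argmax_G score X G` over all undirected graphs on the `p` nodes. -/
def maximizers {n p : ℕ} (X : Matrix (Fin n) (Fin p) ℝ) : Set (SimpleGraph (Fin p)) :=
  {G | ∀ G' : SimpleGraph (Fin p), score X G' ≤ score X G}

/-- The vector of all coordinates of `x` except the `i`-th and the `j`-th. -/
def rest {p : ℕ} (i j : Fin p) (x : EuclideanSpace ℝ (Fin p)) : {k : Fin p // k ≠ i ∧ k ≠ j} → ℝ :=
  fun k => x k

theorem measurable_rest {p : ℕ} (i j : Fin p) : Measurable (rest i j) := by
  unfold rest
  fun_prop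

/-- Under the law `μ` on `ℝ^p`, the coordinates `x_i` and `x_j` are conditionally independent
given all the remaining coordinates. -/
def CondIndepGivenRest {p : ℕ} (μ : Measure (EuclideanSpace ℝ (Fin p))) [IsFiniteMeasure μ]
    (i j : Fin p) : Prop :=
  CondIndepFun (MeasurableSpace.comap (rest i j) inferInstance) (measurable_rest i j).comap_le
    (fun x : EuclideanSpace ℝ (Fin p) => x i) (fun x : EuclideanSpace ℝ (Fin p) => x j) μ

/-- `G` is the conditional independence graph of the law `μ`: two distinct nodes are non-adjacent
if and only if they are conditionally independent given all the remaining variables. -/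
def IsCondIndepGraph {p : ℕ} (μ : Measure (EuclideanSpace ℝ (Fin p))) [IsFiniteMeasure μ]
    (G : SimpleGraph (Fin p)) : Prop :=
  ∀ i j : Fin p, i ≠ j → (¬ G.Adj i j ↔ CondIndepGivenRest μ i j)

/-- The `n × p` data matrix whose `i`-th row is the observation `x i`. -/
def dataMatrix {n p : ℕ} (x : Fin n → EuclideanSpace ℝ (Fin p)) : Matrix (Fin n) (Fin p) ℝ :=
  Matrix.of fun i k => x i k

end FMPL

end

/-! The score is a product of local scores, and a graph is determined by its family of Markov
blankets. It is therefore enough that, for each node `j`, the true blanket strictly beats every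
other set `A` not containing `j`; there are finitely many pairs `(j, A)`.

For a Gaussian law, conditional independence given the rest means `Θ i j = 0`
(`condIndepGivenRest_multivariateGaussian_iff`), so the true blanket of `j` is the off-diagonal
support of column `j` of `Θ`. That column divided by `Θ j j` is the vector `u` of population
regression residual coefficients.

Up to a factor common to all `A`, the local score is `scoreWeight n |A| * r_A ^ (-(n-1)/2)`, where
the determinant ratio `r_A` is a Schur complement: the minimum of `vᵀ S v` over vectors `v`
supported on `A ∪ {j}` with `v j = 1`. On the event that `S` is within `t √n` of `n Θ⁻¹` entrywise,
two regimes occur. Overfitting (`A` strictly contains the blanket): `r_A` is of order `n` but below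
`uᵀ S u` by at most a constant. The likelihood gain is then a bounded factor, while each extra
variable costs a factor of order `n ^ (-1/2)` in the weight. Underfitting (`A` misses a true
neighbour): `r_A` exceeds `uᵀ S u` by a multiple of `n`. The likelihood loss is then exponential in
`n`, against weights that differ only polynomially.

All this is deterministic on the closeness event. Chebyshev bounds the probability of its complement
uniformly in `n` by a quantity that vanishes as `t → ∞`; so `t` is chosen first and `n` afterwards.
-/

noncomputable section

namespace FMPL

/-! ### Conditional independence of shifted noise variables -/

section ConditionalIndependence

/-- The law of a shifted pair: the kernel sending `z` to the law `ν` translated by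
`(m₁ z, m₂ z)`. -/
def shiftKernel {Z : Type*} [MeasurableSpace Z] (ν : Measure (ℝ × ℝ)) (m₁ m₂ : Z → ℝ) :
    Kernel Z (ℝ × ℝ) :=
  (Kernel.id ×ₖ Kernel.const Z ν).map (fun q => (q.2.1 + m₁ q.1, q.2.2 + m₂ q.1))

theorem shiftKernel_apply {Z : Type*} [MeasurableSpace Z] (ν : Measure (ℝ × ℝ))
    [IsProbabilityMeasure ν] {m₁ m₂ : Z → ℝ} (hm₁ : Measurable m₁) (hm₂ : Measurable m₂) (z : Z) :
    shiftKernel ν m₁ m₂ z = ν.map (Prod.map (· + m₁ z) (· + m₂ z)) := by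
  rw [shiftKernel, Kernel.map_apply _ (by fun_prop), Kernel.prod_apply, Kernel.id_apply,
    Kernel.const_apply, Measure.dirac_prod, Measure.map_map (by fun_prop) (by fun_prop)]
  rfl

instance isFiniteKernel_shiftKernel {Z : Type*} [MeasurableSpace Z] (ν : Measure (ℝ × ℝ))
    [IsProbabilityMeasure ν] (m₁ m₂ : Z → ℝ) : IsFiniteKernel (shiftKernel ν m₁ m₂) := by
  unfold shiftKernel
  infer_instance

variable {Ω Z : Type*} [MeasurableSpace Ω] [MeasurableSpace Z] {μ : Measure Ω}
  [IsProbabilityMeasure μ] {z : Ω → Z} {ε₁ ε₂ : Ω → ℝ} {m₁ m₂ : Z → ℝ}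

/-- Independence makes the law of `(z, ε₁, ε₂)` a product; pushing it through the shear `(z, e) ↦
(z, e + m z)` exhibits the joint law as a composition product, which determines the conditional law
almost everywhere. -/
theorem condDistrib_add_ae_eq_shiftKernel (hz : Measurable z) (hε₁ : Measurable ε₁)
    (hε₂ : Measurable ε₂) (hm₁ : Measurable m₁) (hm₂ : Measurable m₂)
    (h : IndepFun z (fun ω => (ε₁ ω, ε₂ ω)) μ) :
    condDistrib (fun ω => (ε₁ ω + m₁ (z ω), ε₂ ω + m₂ (z ω))) z μ
      =ᵐ[μ.map z] shiftKernel (μ.map fun ω => (ε₁ ω, ε₂ ω)) m₁ m₂ := by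
  have hε : Measurable fun ω => (ε₁ ω, ε₂ ω) := by fun_prop
  have : IsProbabilityMeasure (μ.map fun ω => (ε₁ ω, ε₂ ω)) :=
    Measure.isProbabilityMeasure_map hε.aemeasurable
  refine condDistrib_ae_eq_of_measure_eq_compProd z (by fun_prop) ?_
  have h1 : (fun x => (z x, ε₁ x + m₁ (z x), ε₂ x + m₂ (z x))) =
      (fun q : Z × ℝ × ℝ => (q.1, q.2.1 + m₁ q.1, q.2.2 + m₂ q.1)) ∘
        fun ω => (z ω, ε₁ ω, ε₂ ω) := rfl
  rw [h1, ← Measure.map_map (by fun_prop) (by fun_prop),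
    (indepFun_iff_map_prod_eq_prod_map_map hz.aemeasurable hε.aemeasurable).1 h]
  ext s hs
  rw [Measure.map_apply (by fun_prop) hs, Measure.compProd_apply hs, Measure.prod_apply]
  · refine lintegral_congr fun a => ?_
    rw [shiftKernel_apply _ hm₁ hm₂]
    exact (Measure.map_apply (by fun_prop) (measurable_prodMk_left hs)).symm
  · exact MeasurableSet.preimage hs (by fun_prop)

/-- If a pair of noise variables is independent of `z`, then adding functions of `z` to them
produces variables that are conditionally independent given `z` exactly when the noise variables
are independent. -/
theorem condIndepFun_add_iff [StandardBorelSpace Ω] (hz : Measurable z) (hε₁ : Measurable ε₁)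
    (hε₂ : Measurable ε₂) (hm₁ : Measurable m₁) (hm₂ : Measurable m₂)
    (h : IndepFun z (fun ω => (ε₁ ω, ε₂ ω)) μ) :
    CondIndepFun (MeasurableSpace.comap z inferInstance) hz.comap_le
      (fun ω => ε₁ ω + m₁ (z ω)) (fun ω => ε₂ ω + m₂ (z ω)) μ ↔ IndepFun ε₁ ε₂ μ := by
  have hε : Measurable fun ω => (ε₁ ω, ε₂ ω) := by fun_prop
  have : IsProbabilityMeasure (μ.map fun ω => (ε₁ ω, ε₂ ω)) :=
    Measure.isProbabilityMeasure_map hε.aemeasurable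
  have : IsProbabilityMeasure (μ.map z) := Measure.isProbabilityMeasure_map hz.aemeasurable
  have : IsProbabilityMeasure (μ.map ε₁) := Measure.isProbabilityMeasure_map hε₁.aemeasurable
  have : IsProbabilityMeasure (μ.map ε₂) := Measure.isProbabilityMeasure_map hε₂.aemeasurable
  have hf : Measurable fun ω => ε₁ ω + m₁ (z ω) := by fun_prop
  have hg : Measurable fun ω => ε₂ ω + m₂ (z ω) := by fun_prop
  rw [condIndepFun_iff_map_prod_eq_prod_condDistrib_prod_condDistrib hf hg hz,
    ← Measure.compProd_eq_comp_prod,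
    ← condDistrib_ae_eq_iff_measure_eq_compProd z (by fun_prop),
    indepFun_iff_map_prod_eq_prod_map_map hε₁.aemeasurable hε₂.aemeasurable]
  have hpair := condDistrib_add_ae_eq_shiftKernel hz hε₁ hε₂ hm₁ hm₂ h
  have hfst := condDistrib_comp (mβ := ‹MeasurableSpace Z›) (μ := μ) (Y := fun ω => (ε₁ ω + m₁ (z ω), ε₂ ω + m₂ (z ω))) z
    (by fun_prop) (measurable_fst (α := ℝ) (β := ℝ))
  have hsnd := condDistrib_comp (mβ := ‹MeasurableSpace Z›) (μ := μ) (Y := fun ω => (ε₁ ω + m₁ (z ω), ε₂ ω + m₂ (z ω))) z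
    (by fun_prop) (measurable_snd (α := ℝ) (β := ℝ))
  -- At almost every `a`, both sides are translates by `(m₁ a, m₂ a)` of laws free of `a`. Undoing
  -- the translation leaves a condition independent of `a`, so one good point decides it.
  have key : ∀ᵐ a ∂(μ.map z),
      (condDistrib (fun ω => (ε₁ ω + m₁ (z ω), ε₂ ω + m₂ (z ω))) z μ a =
        (condDistrib (fun ω => ε₁ ω + m₁ (z ω)) z μ ×ₖ
          condDistrib (fun ω => ε₂ ω + m₂ (z ω)) z μ) a) ↔
      μ.map (fun ω => (ε₁ ω, ε₂ ω)) = (μ.map ε₁).prod (μ.map ε₂) := by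
    filter_upwards [hpair, hfst, hsnd] with a h0 h1 h2
    have e1 : condDistrib (fun ω => ε₁ ω + m₁ (z ω)) z μ a = (μ.map ε₁).map (· + m₁ a) := by
      refine h1.trans ?_
      rw [Kernel.map_apply _ measurable_fst, h0, shiftKernel_apply _ hm₁ hm₂,
        Measure.map_map (by fun_prop) (by fun_prop), Measure.map_map (by fun_prop) hε,
        Measure.map_map (by fun_prop) hε₁]
      rfl
    have e2 : condDistrib (fun ω => ε₂ ω + m₂ (z ω)) z μ a = (μ.map ε₂).map (· + m₂ a) := by
      refine h2.trans ?_
      rw [Kernel.map_apply _ measurable_snd, h0, shiftKernel_apply _ hm₁ hm₂,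
        Measure.map_map (by fun_prop) (by fun_prop), Measure.map_map (by fun_prop) hε,
        Measure.map_map (by fun_prop) hε₂]
      rfl
    rw [h0, shiftKernel_apply _ hm₁ hm₂, Kernel.prod_apply, e1, e2,
      Measure.map_prod_map _ _ (by fun_prop) (by fun_prop)]
    constructor
    · intro heq
      have hinv (ρ : Measure (ℝ × ℝ)) : (ρ.map (Prod.map (· + m₁ a) (· + m₂ a))).map
          (Prod.map (· + (-m₁ a)) (· + (-m₂ a))) = ρ := by
        rw [Measure.map_map (by fun_prop) (by fun_prop)]
        convert Measure.map_id using 2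
        ext q <;> simp
      have := congrArg (Measure.map (Prod.map (· + (-m₁ a)) (· + (-m₂ a)))) heq
      rwa [hinv, hinv] at this
    · intro heq
      rw [heq]
  constructor
  · intro hae
    obtain ⟨a, ha1, ha2⟩ := (hae.and key).exists
    exact ha2.1 ha1
  · intro heq
    filter_upwards [key] with a ha
    exact ha.2 heq

end ConditionalIndependence

/-! ### Zeros of the precision matrix and the conditional independence graph -/

section Precision

open Matrix in
theorem covariance_linear_multivariateGaussian {p : ℕ} {S : Matrix (Fin p) (Fin p) ℝ}
    (hS : S.PosSemidef) (a b : Fin p → ℝ) :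
    cov[fun x : EuclideanSpace ℝ (Fin p) => ∑ k, a k * x k, fun x => ∑ k, b k * x k;
      multivariateGaussian 0 S] = a ⬝ᵥ S *ᵥ b := by
  have h := covarianceBilin_multivariateGaussian (μ := 0) hS (WithLp.toLp 2 a) (WithLp.toLp 2 b)
  rw [covarianceBilin_apply_eq_cov IsGaussian.memLp_two_id] at h
  convert h using 3 <;> simp [PiLp.inner_apply, mul_comm]

theorem PosDef.det_pair_pos {p : ℕ} {Θ : Matrix (Fin p) (Fin p) ℝ} (hΘ : Θ.PosDef) {i j : Fin p}
    (hij : i ≠ j) : 0 < Θ i i * Θ j j - Θ i j * Θ j i := by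
  have hinj : Function.Injective ![i, j] := by
    intro a b
    fin_cases a <;> fin_cases b <;> simp [hij, hij.symm]
  have := (hΘ.submatrix hinj).det_pos
  rw [Matrix.det_fin_two] at this
  simpa using this

/-- The coefficients of the residual of the linear regression of `x i` on all coordinates other
than `i` and `j`, under a centred Gaussian law with precision matrix `Θ`. -/
def pairResidual {p : ℕ} (Θ : Matrix (Fin p) (Fin p) ℝ) (i j : Fin p) (k : Fin p) : ℝ :=
  (Θ j j * Θ i k - Θ i j * Θ j k) / (Θ i i * Θ j j - Θ i j * Θ j i)

variable {p : ℕ} {Θ : Matrix (Fin p) (Fin p) ℝ} {i j : Fin p}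

theorem pairResidual_self (hΘ : Θ.PosDef) (hij : i ≠ j) : pairResidual Θ i j i = 1 := by
  have := PosDef.det_pair_pos hΘ hij
  rw [pairResidual, div_eq_one_iff_eq this.ne']
  ring

theorem pairResidual_other : pairResidual Θ i j j = 0 := by
  simp [pairResidual, mul_comm]

open Matrix in
-- The residual is a combination of rows `i` and `j` of `Θ`, so `Θ⁻¹` cancels and only `b i` and `b
-- j` survive. In particular the residual is uncorrelated with every other coordinate.
theorem pairResidual_vecMul_inv (hΘ : Θ.PosDef) (b : Fin p → ℝ) :
    pairResidual Θ i j ⬝ᵥ Θ⁻¹ *ᵥ b =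
      (Θ j j * b i - Θ i j * b j) / (Θ i i * Θ j j - Θ i j * Θ j i) := by
  have h1 : pairResidual Θ i j = (Θ i i * Θ j j - Θ i j * Θ j i)⁻¹ •
      ((Θ j j • Pi.single i 1 - Θ i j • Pi.single j 1 : Fin p → ℝ) ᵥ* Θ) := by
    ext k
    simp [pairResidual, Matrix.sub_vecMul, Matrix.smul_vecMul, div_eq_inv_mul]
  have hu : IsUnit Θ.det := (Matrix.isUnit_iff_isUnit_det _).1 hΘ.isUnit
  rw [h1, Matrix.dotProduct_mulVec, Matrix.smul_vecMul, Matrix.vecMul_vecMul,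
    Matrix.mul_nonsing_inv _ hu, Matrix.vecMul_one, smul_dotProduct, sub_dotProduct,
    smul_dotProduct, smul_dotProduct, single_one_dotProduct, single_one_dotProduct]
  simp [div_eq_inv_mul]

theorem sum_eq_pair_add_rest (hij : i ≠ j) (f : Fin p → ℝ) :
    ∑ k, f k = f i + f j + ∑ k : {k : Fin p // k ≠ i ∧ k ≠ j}, f k := by
  classical
  rw [← Finset.sum_subtype (Finset.univ.filter fun k => k ≠ i ∧ k ≠ j) (by simp) f,
    ← Finset.sum_pair hij]
  rw [← Finset.sum_filter_add_sum_filter_not Finset.univ (fun k => k ≠ i ∧ k ≠ j), add_comm]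
  congr 2
  ext k
  simp only [Finset.mem_filter, Finset.mem_univ, true_and, Finset.mem_insert,
    Finset.mem_singleton]
  tauto

/-- In a Gaussian law, two coordinates are conditionally independent given all the others exactly
when the corresponding entry of the precision matrix vanishes. -/
theorem condIndepGivenRest_multivariateGaussian_iff (hΘ : Θ.PosDef) (hij : i ≠ j) :
    CondIndepGivenRest (multivariateGaussian 0 Θ⁻¹) i j ↔ Θ i j = 0 := by
  have hD := PosDef.det_pair_pos hΘ hij
  have hS : (Θ⁻¹).PosSemidef := hΘ.inv.posSemidef
  set μ := multivariateGaussian 0 Θ⁻¹ with hμ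
  let ε₁ : EuclideanSpace ℝ (Fin p) → ℝ := fun x => ∑ k, pairResidual Θ i j k * x k
  let ε₂ : EuclideanSpace ℝ (Fin p) → ℝ := fun x => ∑ k, pairResidual Θ j i k * x k
  have hε₁ : Measurable ε₁ := by fun_prop
  have hε₂ : Measurable ε₂ := by fun_prop
  let m₁ : ({k : Fin p // k ≠ i ∧ k ≠ j} → ℝ) → ℝ :=
    fun r => -∑ k : {k : Fin p // k ≠ i ∧ k ≠ j}, pairResidual Θ i j k * r k
  let m₂ : ({k : Fin p // k ≠ i ∧ k ≠ j} → ℝ) → ℝ :=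
    fun r => -∑ k : {k : Fin p // k ≠ i ∧ k ≠ j}, pairResidual Θ j i k * r k
  have hm₁ : Measurable m₁ := by fun_prop
  have hm₂ : Measurable m₂ := by fun_prop
  have hx₁ : (fun x : EuclideanSpace ℝ (Fin p) => x i) =
      fun x => ε₁ x + m₁ (rest i j x) := by
    ext x
    simp only [ε₁, m₁, rest]
    rw [sum_eq_pair_add_rest hij, pairResidual_self hΘ hij, pairResidual_other]
    ring
  have hx₂ : (fun x : EuclideanSpace ℝ (Fin p) => x j) =
      fun x => ε₂ x + m₂ (rest i j x) := by
    ext x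
    simp only [ε₂, m₂, rest]
    rw [sum_eq_pair_add_rest hij, pairResidual_self hΘ hij.symm, pairResidual_other]
    ring
  have hid : HasGaussianLaw (fun x : EuclideanSpace ℝ (Fin p) => x) μ :=
    IsGaussian.hasGaussianLaw_id
  -- One linear map carries both the remaining coordinates and the two residuals, making them
  -- jointly Gaussian; zero covariance then gives independence.
  let L : EuclideanSpace ℝ (Fin p) →ₗ[ℝ] ({k : Fin p // k ≠ i ∧ k ≠ j} → ℝ) × (Fin 2 → ℝ) :=
    { toFun := fun x => (fun k => x k, fun s => (![ε₁, ε₂] : Fin 2 → _) s x)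
      map_add' := fun x y => by
        ext s
        · simp
        · fin_cases s <;> simp [ε₁, ε₂, mul_add, Finset.sum_add_distrib]
      map_smul' := fun c x => by
        ext s
        · simp
        · fin_cases s <;> simp [ε₁, ε₂, Finset.mul_sum, mul_left_comm] }
  have hL : HasGaussianLaw (fun x => ((fun k : {k : Fin p // k ≠ i ∧ k ≠ j} => x k),
      (fun s => (![ε₁, ε₂] : Fin 2 → _) s x))) μ :=
    hid.map_fun (LinearMap.toContinuousLinearMap L)
  have hcoord (k : Fin p) : (fun x : EuclideanSpace ℝ (Fin p) => x k) =
      fun x => ∑ l, (Pi.single k 1 : Fin p → ℝ) l * x l := by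
    ext x
    simp [Pi.single_apply]
  have hindep : IndepFun (rest i j) (fun x => (ε₁ x, ε₂ x)) μ := by
    have := hL.indepFun_of_covariance_eval (X := fun (k : {k : Fin p // k ≠ i ∧ k ≠ j}) x => x k)
      (Y := ![ε₁, ε₂]) ?_
    · exact this.comp (φ := id) (ψ := fun v : Fin 2 → ℝ => (v 0, v 1)) measurable_id (by fun_prop)
    · rintro ⟨k, hki, hkj⟩ s
      rw [covariance_comm]
      fin_cases s
      · simp only [hcoord k]
        refine (covariance_linear_multivariateGaussian hS _ _).trans ?_
        rw [pairResidual_vecMul_inv hΘ]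
        simp [hki.symm, hkj.symm]
      · simp only [hcoord k]
        refine (covariance_linear_multivariateGaussian hS _ _).trans ?_
        rw [pairResidual_vecMul_inv hΘ]
        simp [hki.symm, hkj.symm]
  -- The residual covariance is the off-diagonal entry of the inverse of the `{i, j}` block of `Θ`.
  have hcov : cov[ε₁, ε₂; μ] = -Θ i j / (Θ i i * Θ j j - Θ i j * Θ j i) := by
    refine (covariance_linear_multivariateGaussian hS _ _).trans ?_
    rw [pairResidual_vecMul_inv hΘ, pairResidual_other, pairResidual_self hΘ hij.symm]
    ring
  have h2 : HasGaussianLaw (fun x => (ε₁ x, ε₂ x)) μ := by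
    have := hL.snd.prodMk 0 1
    exact this
  rw [CondIndepGivenRest, hx₁, hx₂,
    condIndepFun_add_iff (measurable_rest i j) hε₁ hε₂ hm₁ hm₂ hindep]
  constructor
  · intro h
    have := h.covariance_eq_zero h2.fst.memLp_two h2.snd.memLp_two
    rw [hcov, div_eq_zero_iff, neg_eq_zero] at this
    exact this.resolve_right hD.ne'
  · intro h
    exact h2.indepFun_of_covariance_eq_zero (by rw [hcov, h]; simp)

theorem IsCondIndepGraph.adj_iff {G : SimpleGraph (Fin p)} (hΘ : Θ.PosDef)
    (hG : IsCondIndepGraph (multivariateGaussian 0 Θ⁻¹) G) (hij : i ≠ j) :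
    G.Adj i j ↔ Θ i j ≠ 0 := by
  rw [← not_iff_not, hG i j hij, condIndepGivenRest_multivariateGaussian_iff hΘ hij, not_not]

end Precision

/-! ### Determinant ratios as least-squares minima -/

section Regression

open Matrix

section Quadratic

variable {p : ℕ} {S : Matrix (Fin p) (Fin p) ℝ}

theorem IsSymm.dotProduct_mulVec_comm (hS : S.IsSymm) (v w : Fin p → ℝ) :
    v ⬝ᵥ S *ᵥ w = w ⬝ᵥ S *ᵥ v := by
  rw [dotProduct_mulVec, ← mulVec_transpose, hS.eq, dotProduct_comm]

theorem IsSymm.quadratic_add (hS : S.IsSymm) (u d : Fin p → ℝ) :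
    (u + d) ⬝ᵥ S *ᵥ (u + d) = u ⬝ᵥ S *ᵥ u + 2 * (d ⬝ᵥ S *ᵥ u) + d ⬝ᵥ S *ᵥ d := by
  rw [mulVec_add, add_dotProduct, dotProduct_add, dotProduct_add,
    IsSymm.dotProduct_mulVec_comm hS u d]
  ring

theorem PosDef.isSymm (hS : S.PosDef) : S.IsSymm := by
  have := hS.isHermitian
  rwa [IsHermitian, conjTranspose_eq_transpose_of_trivial] at this

theorem PosDef.quadratic_nonneg (hS : S.PosDef) (w : Fin p → ℝ) : 0 ≤ w ⬝ᵥ S *ᵥ w := by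
  simpa using hS.posSemidef.dotProduct_mulVec_nonneg w

theorem minor_pos (hS : S.PosDef) (A : Finset (Fin p)) : 0 < minor S A :=
  (hS.submatrix Subtype.val_injective).det_pos

/-- Schur's determinant formula, after reordering the indices so that the block `A` comes first and
`j` last. -/
theorem minor_insert_eq (hS : S.PosDef) {j : Fin p} {A : Finset (Fin p)} (hj : j ∉ A) :
    minor S (insert j A) = minor S A * (S j j - (fun k : A => S j k) ⬝ᵥ
      (S.submatrix (fun i : A => (i : Fin p)) (fun i : A => (i : Fin p)))⁻¹ *ᵥ
        fun k : A => S k j) := by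
  have hM : (S.submatrix (fun i : A => (i : Fin p)) (fun i : A => (i : Fin p))).PosDef :=
    hS.submatrix Subtype.val_injective
  let := hM.isUnit.invertible
  let e : ↥(insert j A) ≃ ↥A ⊕ PUnit.{1} :=
    (Finset.subtypeInsertEquivOption hj).trans (Equiv.optionEquivSumPUnit _)
  rw [minor, ← det_submatrix_equiv_self e.symm, submatrix_submatrix]
  have hb : S.submatrix ((fun i : ↥(insert j A) => (i : Fin p)) ∘ e.symm)
      ((fun i : ↥(insert j A) => (i : Fin p)) ∘ e.symm) =
      fromBlocks (S.submatrix (fun i : A => (i : Fin p)) (fun i : A => (i : Fin p)))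
        (of fun k _ => S k j) (of fun _ k => S j k) (of fun _ _ => S j j) := by
    ext a b
    rcases a with a | a <;> rcases b with b | b <;> rfl
  rw [hb, det_fromBlocks₁₁, det_unique (n := PUnit), minor]
  congr 1
  rw [Matrix.mul_assoc, invOf_eq_nonsing_inv]
  simp only [Matrix.sub_apply, of_apply, mul_apply, dotProduct, mulVec]

/-- The regression vector of coordinate `j` on the coordinates in `A`: it is supported on
`insert j A`, has `j`-th entry `1`, and its `S`-form is the Schur complement. -/
theorem exists_regression (hS : S.PosDef) {j : Fin p} {A : Finset (Fin p)} (hj : j ∉ A) :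
    ∃ w : Fin p → ℝ, w j = 1 ∧ (∀ k, k ∉ insert j A → w k = 0) ∧ (∀ k ∈ A, (S *ᵥ w) k = 0) ∧
      minor S (insert j A) = minor S A * (S *ᵥ w) j := by
  classical
  set M := S.submatrix (fun i : A => (i : Fin p)) (fun i : A => (i : Fin p)) with hMdef
  have hM : M.PosDef := hS.submatrix Subtype.val_injective
  set β : A → ℝ := M⁻¹ *ᵥ fun k : A => S k j with hβ
  let w : Fin p → ℝ := fun k => if h : k ∈ A then -β ⟨k, h⟩ else if k = j then 1 else 0
  have hSw (l : Fin p) : (S *ᵥ w) l = S l j - ∑ k : A, S l k * β k := by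
    have h1 : ∀ k, S l k * w k =
        (if k = j then S l j else 0) - if h : k ∈ A then S l k * β ⟨k, h⟩ else 0 := by
      intro k
      by_cases hk : k ∈ A
      · have : k ≠ j := fun h => hj (h ▸ hk)
        simp [w, hk, this]
      · by_cases hkj : k = j
        · subst hkj
          simp [w, hk]
        · simp [w, hk, hkj]
    rw [mulVec, dotProduct, Finset.sum_congr rfl fun k _ => h1 k, Finset.sum_sub_distrib]
    congr 1
    · simp
    · calc (∑ k, if h : k ∈ A then S l k * β ⟨k, h⟩ else 0)
          = ∑ k, if k ∈ A then S l k * (if h : k ∈ A then β ⟨k, h⟩ else 0) else 0 := by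
            refine Finset.sum_congr rfl fun k _ => ?_
            by_cases hk : k ∈ A <;> simp [hk]
        _ = ∑ k ∈ A, S l k * (if h : k ∈ A then β ⟨k, h⟩ else 0) := by
            rw [Finset.sum_ite_mem, Finset.univ_inter]
        _ = ∑ k : A, S l k * (if h : (k : Fin p) ∈ A then β ⟨k, h⟩ else 0) :=
            (Finset.sum_coe_sort A fun k => S l k * (if h : k ∈ A then β ⟨k, h⟩ else 0)).symm
        _ = _ := by simp
  refine ⟨w, by simp [w, hj], fun k hk => ?_, fun k hk => ?_, ?_⟩
  · simp only [Finset.mem_insert, not_or] at hk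
    simp [w, hk]
  · have : M *ᵥ β = fun k : A => S k j := by
      rw [hβ, mulVec_mulVec, mul_nonsing_inv _ ((isUnit_iff_isUnit_det _).1 hM.isUnit),
        one_mulVec]
    have hk' := congrFun this ⟨k, hk⟩
    rw [hSw, ← hk']
    simp [mulVec, dotProduct, hMdef]
  · rw [minor_insert_eq hS hj, hSw]
    rfl

/-- The normal equations kill the coordinates in `A` and the support condition kills those outside,
leaving only `j`. Hence every competitor `v` has the same `S`-product with `w`. -/
theorem dotProduct_regression {j : Fin p} {A : Finset (Fin p)} {w v : Fin p → ℝ}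
    (hv : v j = 1) (hvA : ∀ k, k ∉ insert j A → v k = 0) (hw : ∀ k ∈ A, (S *ᵥ w) k = 0) :
    v ⬝ᵥ S *ᵥ w = (S *ᵥ w) j := by
  rw [dotProduct, Finset.sum_eq_single j]
  · rw [hv, one_mul]
  · intro k _ hk
    by_cases hkA : k ∈ A
    · rw [hw k hkA, mul_zero]
    · rw [hvA k (by simp [hk, hkA]), zero_mul]
  · simp

/-- The residual sum of squares of the regression of coordinate `j` on the coordinates in `A`. -/
def residual (S : Matrix (Fin p) (Fin p) ℝ) (j : Fin p) (A : Finset (Fin p)) : ℝ :=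
  minor S (insert j A) / minor S A

theorem exists_quadratic_eq_residual (hS : S.PosDef) {j : Fin p} {A : Finset (Fin p)}
    (hj : j ∉ A) : ∃ w : Fin p → ℝ, w j = 1 ∧ (∀ k, k ∉ insert j A → w k = 0) ∧
      residual S j A = w ⬝ᵥ S *ᵥ w := by
  obtain ⟨w, hwj, hwA, hSw, hm⟩ := exists_regression hS hj
  refine ⟨w, hwj, hwA, ?_⟩
  rw [residual, hm, mul_div_cancel_left₀ _ (minor_pos hS A).ne',
    dotProduct_regression hwj hwA hSw]

/-- Pythagoras: in `v = w + (v - w)` the cross term vanishes by the normal equations, and the form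
of `v - w` is nonnegative. -/
theorem residual_le_quadratic (hS : S.PosDef) {j : Fin p} {A : Finset (Fin p)}
    (hj : j ∉ A) {v : Fin p → ℝ} (hv : v j = 1) (hvA : ∀ k, k ∉ insert j A → v k = 0) :
    residual S j A ≤ v ⬝ᵥ S *ᵥ v := by
  obtain ⟨w, hwj, hwA, hSw, hm⟩ := exists_regression hS hj
  rw [residual, hm, mul_div_cancel_left₀ _ (minor_pos hS A).ne']
  have h1 := PosDef.quadratic_nonneg hS (v - w)
  have h2 := IsSymm.quadratic_add (PosDef.isSymm hS) w (v - w)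
  rw [add_sub_cancel, sub_dotProduct, dotProduct_regression hv hvA hSw,
    dotProduct_regression hwj hwA hSw] at h2
  linarith

end Quadratic

end Regression

/-! ### Growth of the data-free factor in `n` -/

section Weights

/-- Log-convexity of Gamma at the midpoint of `x` and `x + 1`. -/
theorem gamma_add_half_le {x : ℝ} (hx : 0 < x) :
    Real.Gamma (x + 1 / 2) ≤ √x * Real.Gamma x := by
  have h := Real.Gamma_mul_add_mul_le_rpow_Gamma_mul_rpow_Gamma hx (t := x + 1) (by linarith)
    (a := 1 / 2) (b := 1 / 2) (by norm_num) (by norm_num) (by norm_num)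
  have hG := Real.Gamma_pos_of_pos hx
  rw [Real.Gamma_add_one hx.ne', ← Real.sqrt_eq_rpow, ← Real.sqrt_eq_rpow,
    Real.sqrt_mul hx.le] at h
  calc Real.Gamma (x + 1 / 2) = Real.Gamma (1 / 2 * x + 1 / 2 * (x + 1)) := by ring_nf
    _ ≤ _ := h
    _ = √x * (√(Real.Gamma x) * √(Real.Gamma x)) := by ring
    _ = _ := by rw [Real.mul_self_sqrt hG.le]

/-- The factor of the local score that does not depend on the data, up to a power of `π`. -/
def scoreWeight (n a : ℕ) : ℝ :=
  Real.Gamma (((n : ℝ) + (a : ℝ)) / 2) / Real.Gamma (((a : ℝ) + 1) / 2)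
    * (n : ℝ) ^ (-((2 * (a : ℝ) + 1) / 2))

theorem scoreWeight_pos {n : ℕ} (hn : 0 < n) (a : ℕ) : 0 < scoreWeight n a := by
  have hn' : (0 : ℝ) < n := by exact_mod_cast hn
  have h1 := Real.Gamma_pos_of_pos (s := ((n : ℝ) + (a : ℝ)) / 2) (by positivity)
  have h2 := Real.Gamma_pos_of_pos (s := ((a : ℝ) + 1) / 2) (by positivity)
  unfold scoreWeight
  positivity

theorem scoreWeight_succ {n : ℕ} (hn : 0 < n) (a : ℕ) :
    scoreWeight n (a + 1) = scoreWeight n a *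
      (Real.Gamma (((n : ℝ) + a) / 2 + 1 / 2) / Real.Gamma (((n : ℝ) + a) / 2)) *
      (Real.Gamma (((a : ℝ) + 1) / 2) / Real.Gamma (((a : ℝ) + 2) / 2)) * (n : ℝ)⁻¹ := by
  have hn' : (0 : ℝ) < n := by exact_mod_cast hn
  have h1 := Real.Gamma_pos_of_pos (s := ((n : ℝ) + (a : ℝ)) / 2) (by positivity)
  have h2 := Real.Gamma_pos_of_pos (s := ((a : ℝ) + 1) / 2) (by positivity)
  have h3 : (n : ℝ) ^ (-((2 * ((a + 1 : ℕ) : ℝ) + 1) / 2)) =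
      (n : ℝ) ^ (-((2 * (a : ℝ) + 1) / 2)) * (n : ℝ)⁻¹ := by
    rw [← Real.rpow_neg_one, ← Real.rpow_add hn']
    congr 1
    push_cast
    ring
  have h4 : ((n : ℝ) + ((a + 1 : ℕ) : ℝ)) / 2 = ((n : ℝ) + a) / 2 + 1 / 2 := by
    push_cast
    ring
  have h5 : (((a + 1 : ℕ) : ℝ) + 1) / 2 = ((a : ℝ) + 2) / 2 := by
    push_cast
    ring
  rw [scoreWeight, scoreWeight, h3, h4, h5]
  field_simp

/-- One more variable multiplies the Gamma quotient by at most order `√n` and the power of `n` by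
`n⁻¹`. The net `n ^ (-1/2)` is the penalty that rules out overfitting. -/
theorem exists_scoreWeight_succ_le (a : ℕ) : ∃ C : ℝ, 0 < C ∧ ∀ n : ℕ, 0 < n →
    scoreWeight n (a + 1) ≤ C * (√n)⁻¹ * scoreWeight n a := by
  have h2 := Real.Gamma_pos_of_pos (s := ((a : ℝ) + 1) / 2) (by positivity)
  have h3 := Real.Gamma_pos_of_pos (s := ((a : ℝ) + 2) / 2) (by positivity)
  set D := Real.Gamma (((a : ℝ) + 1) / 2) / Real.Gamma (((a : ℝ) + 2) / 2)
  have hD : 0 < D := by positivity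
  refine ⟨√(1 + a) * D, by positivity, fun n hn => ?_⟩
  have hn' : (1 : ℝ) ≤ n := by exact_mod_cast hn
  have hx : 0 < ((n : ℝ) + a) / 2 := by positivity
  have hG := Real.Gamma_pos_of_pos hx
  have hw := scoreWeight_pos hn a
  have hs : 0 < √(n : ℝ) := Real.sqrt_pos.2 (by linarith)
  have h6 : Real.Gamma (((n : ℝ) + a) / 2 + 1 / 2) / Real.Gamma (((n : ℝ) + a) / 2) ≤
      √(1 + a) * √n := by
    rw [div_le_iff₀ hG, ← Real.sqrt_mul (by positivity)]
    refine (gamma_add_half_le hx).trans ?_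
    gcongr
    nlinarith [(Nat.cast_nonneg a : (0 : ℝ) ≤ a)]
  rw [scoreWeight_succ hn]
  calc _ ≤ scoreWeight n a * (√(1 + a) * √n) * D * (n : ℝ)⁻¹ := by gcongr
    _ = √(1 + a) * D * (√n * (n : ℝ)⁻¹) * scoreWeight n a := by ring
    _ = _ := by
      congr 2
      nth_rewrite 2 [← Real.mul_self_sqrt (by linarith : (0 : ℝ) ≤ n)]
      field_simp

/-- The factor `n` is not sharp; any polynomial bound will do, since it is only played against
exponential decay. -/
theorem exists_scoreWeight_le_succ (a : ℕ) : ∃ C : ℝ, 0 < C ∧ ∀ n : ℕ, 0 < n →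
    scoreWeight n a ≤ C * n * scoreWeight n (a + 1) := by
  have h2 := Real.Gamma_pos_of_pos (s := ((a : ℝ) + 1) / 2) (by positivity)
  have h3 := Real.Gamma_pos_of_pos (s := ((a : ℝ) + 2) / 2) (by positivity)
  set D := Real.Gamma (((a : ℝ) + 1) / 2) / Real.Gamma (((a : ℝ) + 2) / 2) with hDdef
  have hD : 0 < D := by positivity
  refine ⟨2 * D⁻¹, by positivity, fun n hn => ?_⟩
  have hn' : (1 : ℝ) ≤ n := by exact_mod_cast hn
  set x := ((n : ℝ) + a) / 2 with hxdef
  have hx : 1 / 2 ≤ x := by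
    have := (Nat.cast_nonneg a : (0 : ℝ) ≤ a)
    linarith
  have hG := Real.Gamma_pos_of_pos (s := x) (by linarith)
  have hG2 := Real.Gamma_pos_of_pos (s := x + 1 / 2) (by linarith)
  have hw := scoreWeight_pos hn a
  -- The half-step inequality at `x + 1/2` reads `x Γ(x) ≤ √(x + 1/2) Γ(x + 1/2)`, and `√(x + 1/2) ≤
  -- 2x` holds exactly because `x ≥ 1/2`.
  have h6 : 1 / 2 ≤ Real.Gamma (x + 1 / 2) / Real.Gamma x := by
    rw [le_div_iff₀ hG]
    have h7 := gamma_add_half_le (x := x + 1 / 2) (by linarith)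
    rw [add_assoc, add_halves, Real.Gamma_add_one (by linarith)] at h7
    have h8 : √(x + 1 / 2) ≤ 2 * x := by
      rw [Real.sqrt_le_left (by linarith)]
      nlinarith
    have h9 : x * Real.Gamma x ≤ 2 * x * Real.Gamma (x + 1 / 2) :=
      h7.trans (by gcongr)
    have hx0 : 0 < x := by linarith
    nlinarith
  have hn0 : (0 : ℝ) < n := by linarith
  rw [scoreWeight_succ hn]
  calc scoreWeight n a = 2 * D⁻¹ * n * (scoreWeight n a * (1 / 2) * D * (n : ℝ)⁻¹) := by
        field_simp
    _ ≤ _ := by gcongr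

theorem tendsto_scoreWeight_div_of_lt {a b : ℕ} (hab : a < b) :
    Tendsto (fun n => scoreWeight n b / scoreWeight n a) atTop (𝓝 0) := by
  have hstep (a : ℕ) :
      Tendsto (fun n => scoreWeight n (a + 1) / scoreWeight n a) atTop (𝓝 0) := by
    obtain ⟨C, hC, h⟩ := exists_scoreWeight_succ_le a
    have hlim : Tendsto (fun n : ℕ => C * (√(n : ℝ))⁻¹) atTop (𝓝 0) := by
      have : Tendsto (fun n : ℕ => √(n : ℝ)) atTop atTop :=
        Real.tendsto_sqrt_atTop.comp tendsto_natCast_atTop_atTop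
      simpa using this.inv_tendsto_atTop.const_mul C
    refine squeeze_zero' ?_ ?_ hlim
    · filter_upwards [eventually_gt_atTop 0] with n hn
      exact (div_pos (scoreWeight_pos hn _) (scoreWeight_pos hn _)).le
    · filter_upwards [eventually_gt_atTop 0] with n hn
      rw [div_le_iff₀ (scoreWeight_pos hn _)]
      exact h n hn
  induction b, hab using Nat.le_induction with
  | base => exact hstep a
  | succ b hb ih =>
    have := (hstep b).mul ih
    rw [mul_zero] at this
    refine this.congr' ?_
    filter_upwards [eventually_gt_atTop 0] with n hn
    have := scoreWeight_pos hn b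
    field_simp

theorem eventually_scoreWeight_mul_lt {a b : ℕ} (hab : a < b) (B : ℝ) :
    ∀ᶠ n in atTop, scoreWeight n b * B < scoreWeight n a := by
  have h := (tendsto_scoreWeight_div_of_lt hab).mul_const B
  rw [zero_mul] at h
  filter_upwards [eventually_gt_atTop 0, h.eventually_lt_const one_pos] with n hn h1
  have := scoreWeight_pos hn a
  rw [div_mul_eq_mul_div, div_lt_one this] at h1
  exact h1

theorem exists_scoreWeight_le_pow (a b : ℕ) : ∃ C : ℝ, 0 < C ∧ ∃ M : ℕ, ∀ n : ℕ, 0 < n →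
    scoreWeight n a ≤ C * (n : ℝ) ^ M * scoreWeight n b := by
  rcases le_total a b with hab | hab
  · induction b, hab using Nat.le_induction with
    | base => exact ⟨1, one_pos, 0, fun n _ => by simp⟩
    | succ b hb ih =>
      obtain ⟨C, hC, M, h⟩ := ih
      obtain ⟨C', hC', h'⟩ := exists_scoreWeight_le_succ b
      refine ⟨C * C', by positivity, M + 1, fun n hn => (h n hn).trans ?_⟩
      calc C * (n : ℝ) ^ M * scoreWeight n b
          ≤ C * (n : ℝ) ^ M * (C' * n * scoreWeight n (b + 1)) := by
            gcongr
            exact h' n hn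
        _ = _ := by ring
  · induction a, hab using Nat.le_induction with
    | base => exact ⟨1, one_pos, 0, fun n _ => by simp⟩
    | succ a ha ih =>
      obtain ⟨C, hC, M, h⟩ := ih
      obtain ⟨C', hC', h'⟩ := exists_scoreWeight_succ_le a
      refine ⟨C' * C, by positivity, M, fun n hn => (h' n hn).trans ?_⟩
      have hn' : (1 : ℝ) ≤ n := by exact_mod_cast hn
      have h1 : (√(n : ℝ))⁻¹ ≤ 1 := inv_le_one_of_one_le₀ (Real.one_le_sqrt.2 hn')
      have := scoreWeight_pos hn a
      calc C' * (√(n : ℝ))⁻¹ * scoreWeight n a ≤ C' * 1 * scoreWeight n a := by gcongr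
        _ ≤ C' * 1 * (C * (n : ℝ) ^ M * scoreWeight n b) := by
            gcongr
            exact h n hn
        _ = _ := by ring

theorem eventually_scoreWeight_mul_rpow_lt (a b : ℕ) {q : ℝ} (hq0 : 0 < q) (hq1 : q < 1) :
    ∀ᶠ n : ℕ in atTop, scoreWeight n a * q ^ (((n : ℝ) - 1) / 2) < scoreWeight n b := by
  obtain ⟨C, hC, M, h⟩ := exists_scoreWeight_le_pow a b
  have hs0 : 0 < √q := Real.sqrt_pos.2 hq0
  have hs1 : √q < 1 := by rw [Real.sqrt_lt' one_pos]; simpa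
  have hlim := ((tendsto_pow_const_mul_const_pow_of_abs_lt_one M
    (by rwa [abs_of_pos hs0] : |√q| < 1)).const_mul (C * (√q)⁻¹))
  rw [mul_zero] at hlim
  filter_upwards [eventually_gt_atTop 0, hlim.eventually_lt_const one_pos] with n hn h1
  have hw := scoreWeight_pos hn b
  have hq : q ^ (((n : ℝ) - 1) / 2) = (√q)⁻¹ * √q ^ n := by
    rw [Real.sqrt_eq_rpow, ← Real.rpow_natCast, ← Real.rpow_mul hq0.le, ← Real.rpow_neg hq0.le,
      ← Real.rpow_add hq0]
    congr 1
    ring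
  calc scoreWeight n a * q ^ (((n : ℝ) - 1) / 2)
      ≤ (C * (n : ℝ) ^ M * scoreWeight n b) * ((√q)⁻¹ * √q ^ n) := by
        rw [hq]
        gcongr
        exact h n hn
    _ = (C * (√q)⁻¹ * ((n : ℝ) ^ M * √q ^ n)) * scoreWeight n b := by ring
    _ < 1 * scoreWeight n b := by gcongr
    _ = _ := one_mul _

end Weights

/-! ### Deterministic consequences of `S` being close to `n Θ⁻¹` -/

section Deviations

open Matrix

section Deviation

variable {p : ℕ} {Θ S : Matrix (Fin p) (Fin p) ℝ}

/-- The coefficients of the residual of the population regression of coordinate `j` on all other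
coordinates, for the precision matrix `Θ`. -/
def nodeResidual (Θ : Matrix (Fin p) (Fin p) ℝ) (j k : Fin p) : ℝ := Θ k j / Θ j j

theorem nodeResidual_self (hΘ : Θ.PosDef) (j : Fin p) : nodeResidual Θ j j = 1 :=
  div_self hΘ.diag_pos.ne'

theorem inv_mulVec_nodeResidual (hΘ : Θ.PosDef) (j : Fin p) :
    Θ⁻¹ *ᵥ nodeResidual Θ j = Pi.single j (Θ j j)⁻¹ := by
  have h : nodeResidual Θ j = Θ *ᵥ Pi.single j (Θ j j)⁻¹ := by
    ext k
    simp [nodeResidual, div_eq_mul_inv]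
  rw [h, mulVec_mulVec, nonsing_inv_mul _ ((isUnit_iff_isUnit_det _).1 hΘ.isUnit), one_mulVec]

/-- Bounds the least eigenvalue of `Θ⁻¹` below by `1 / tr Θ`. With `w k` fixed, the form `wᵀ Θ⁻¹ w`
is at least `(w k)² / Θ k k`, as seen by subtracting from `w` the multiple `w k` of the residual
vector of `k`; summing over `k` gives the trace. -/
theorem PosDef.dotProduct_self_le_trace_mul (hΘ : Θ.PosDef) (w : Fin p → ℝ) :
    w ⬝ᵥ w ≤ Θ.trace * (w ⬝ᵥ Θ⁻¹ *ᵥ w) := by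
  have hk (k : Fin p) : w k * w k ≤ Θ k k * (w ⬝ᵥ Θ⁻¹ *ᵥ w) := by
    have hd : 0 < Θ k k := hΘ.diag_pos
    have h0 := PosDef.quadratic_nonneg hΘ.inv (w + (-w k) • nodeResidual Θ k)
    have h1 : nodeResidual Θ k ⬝ᵥ Θ⁻¹ *ᵥ w = w k * (Θ k k)⁻¹ := by
      rw [IsSymm.dotProduct_mulVec_comm (PosDef.isSymm hΘ.inv), inv_mulVec_nodeResidual hΘ,
        dotProduct_single]
    have h2 : nodeResidual Θ k ⬝ᵥ Θ⁻¹ *ᵥ nodeResidual Θ k = (Θ k k)⁻¹ := by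
      rw [inv_mulVec_nodeResidual hΘ, dotProduct_single, nodeResidual_self hΘ, one_mul]
    rw [IsSymm.quadratic_add (PosDef.isSymm hΘ.inv)] at h0
    simp only [mulVec_smul, smul_dotProduct, dotProduct_smul, h1, h2, smul_eq_mul] at h0
    have h3 : w k * w k * (Θ k k)⁻¹ ≤ w ⬝ᵥ Θ⁻¹ *ᵥ w := by linarith
    rwa [← div_eq_mul_inv, div_le_iff₀' hd] at h3
  rw [trace, Finset.sum_mul, dotProduct]
  exact Finset.sum_le_sum fun k _ => hk k

theorem abs_dotProduct_mulVec_le {E : Matrix (Fin p) (Fin p) ℝ} {r : ℝ}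
    (hE : ∀ k l, |E k l| ≤ r) (v w : Fin p → ℝ) :
    |v ⬝ᵥ E *ᵥ w| ≤ r * (∑ k, |v k|) * ∑ l, |w l| := by
  have h1 : v ⬝ᵥ E *ᵥ w = ∑ k, ∑ l, v k * (E k l * w l) := by
    simp only [dotProduct, mulVec, Finset.mul_sum]
  rw [h1, mul_assoc, Finset.sum_mul_sum, Finset.mul_sum]
  refine (Finset.abs_sum_le_sum_abs _ _).trans (Finset.sum_le_sum fun k _ => ?_)
  rw [Finset.mul_sum]
  refine (Finset.abs_sum_le_sum_abs _ _).trans (Finset.sum_le_sum fun l _ => ?_)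
  rw [abs_mul, abs_mul]
  have := mul_le_mul_of_nonneg_right (hE k l) (mul_nonneg (abs_nonneg (v k)) (abs_nonneg (w l)))
  linarith

theorem sq_sum_abs_le (w : Fin p → ℝ) : (∑ k, |w k|) ^ 2 ≤ p * (w ⬝ᵥ w) := by
  have := sq_sum_le_card_mul_sum_sq (s := Finset.univ) (f := fun k => |w k|)
  simpa [dotProduct, sq] using this

/-- The matrix `S` is within `t √n` of `n Σ`, entrywise. -/
def IsClose (Sigma : Matrix (Fin p) (Fin p) ℝ) (t : ℝ) (n : ℕ) (S : Matrix (Fin p) (Fin p) ℝ) :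
    Prop :=
  ∀ k l, |S k l - n * Sigma k l| ≤ t * √n

theorem IsClose.abs_form_sub_le {Sigma : Matrix (Fin p) (Fin p) ℝ} {t : ℝ} {n : ℕ}
    (h : IsClose Sigma t n S) (v w : Fin p → ℝ) :
    |v ⬝ᵥ S *ᵥ w - n * (v ⬝ᵥ Sigma *ᵥ w)| ≤ t * √n * (∑ k, |v k|) * ∑ l, |w l| := by
  have := abs_dotProduct_mulVec_le (E := S - (n : ℝ) • Sigma) (r := t * √n)
    (fun k l => by simpa using h k l) v w
  rwa [sub_mulVec, smul_mulVec, dotProduct_sub, dotProduct_smul, smul_eq_mul] at this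

/-- The quadratic form of `S` is at least `c n` times the Euclidean one, is at most `C n` at `u`,
and `S u` is of order `√(K n)` away from coordinate `j`. -/
structure IsRegular (c C K : ℝ) (n : ℕ) (j : Fin p) (u : Fin p → ℝ)
    (S : Matrix (Fin p) (Fin p) ℝ) : Prop where
  symm : S.IsSymm
  lower : ∀ w, c * n * (w ⬝ᵥ w) ≤ w ⬝ᵥ S *ᵥ w
  upper : u ⬝ᵥ S *ᵥ u ≤ C * n
  gradient : ∀ d : Fin p → ℝ, d j = 0 → (d ⬝ᵥ S *ᵥ u) ^ 2 ≤ K * n * (d ⬝ᵥ d)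

/-- The key fact is that `Θ⁻¹ u` is supported at `j`: for `d j = 0` the population part of `dᵀ S u`
vanishes and only the `t √n` error remains. The other two bounds perturb the population form. -/
theorem exists_isRegular (hΘ : Θ.PosDef) (t : ℝ) (ht : 0 ≤ t) (j : Fin p) :
    ∃ c C K : ℝ, 0 < c ∧ 0 < C ∧ 0 < K ∧ ∀ᶠ n : ℕ in atTop, ∀ S : Matrix (Fin p) (Fin p) ℝ,
      S.IsSymm → IsClose Θ⁻¹ t n S → IsRegular c C K n j (nodeResidual Θ j) S := by
  set u := nodeResidual Θ j with hu
  set U := ∑ k, |u k| with hU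
  have hU0 : 0 ≤ U := Finset.sum_nonneg fun _ _ => abs_nonneg _
  have huj : u j = 1 := nodeResidual_self hΘ j
  have htr : 0 < Θ.trace :=
    Finset.sum_pos (fun k _ => hΘ.diag_pos) ⟨j, Finset.mem_univ j⟩
  have hd : 0 < Θ j j := hΘ.diag_pos
  -- Half of the population bound `1 / tr Θ` is given up to the error, which is affordable once `√n
  -- ≥ 2 t p tr Θ`. The `+ 1` in the last constant only ensures positivity.
  refine ⟨Θ.trace⁻¹ / 2, (Θ j j)⁻¹ + t * U * U, t ^ 2 * p * U ^ 2 + 1, by positivity,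
    by positivity, by positivity, ?_⟩
  have hev : ∀ᶠ n : ℕ in atTop, t * p * (2 * Θ.trace) ≤ √(n : ℝ) :=
    (Real.tendsto_sqrt_atTop.comp tendsto_natCast_atTop_atTop).eventually_ge_atTop _
  filter_upwards [hev, eventually_gt_atTop 0] with n hn hn0 S hS hclose
  have hn1 : (1 : ℝ) ≤ n := by exact_mod_cast hn0
  have hsn : √(n : ℝ) * √n = n := Real.mul_self_sqrt (by linarith)
  have hs1 : 1 ≤ √(n : ℝ) := Real.one_le_sqrt.2 hn1
  refine ⟨hS, fun w => ?_, ?_, fun d hdj => ?_⟩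
  · have h1 := (abs_le.1 (hclose.abs_form_sub_le w w)).1
    have h2 := PosDef.dotProduct_self_le_trace_mul hΘ w
    have h3 := sq_sum_abs_le w
    have h4 : Θ.trace⁻¹ * (w ⬝ᵥ w) ≤ w ⬝ᵥ Θ⁻¹ *ᵥ w := by
      rwa [inv_mul_le_iff₀ htr]
    have hw0 : 0 ≤ w ⬝ᵥ w := Finset.sum_nonneg fun k _ => mul_self_nonneg _
    have h5 : t * √n * (∑ k, |w k|) * ∑ l, |w l| ≤ t * √n * (p * (w ⬝ᵥ w)) := by
      rw [mul_assoc (t * √n), ← sq]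
      gcongr
    have h6 : t * √n * (p * (w ⬝ᵥ w)) ≤ Θ.trace⁻¹ / 2 * n * (w ⬝ᵥ w) := by
      rw [← mul_assoc]
      refine mul_le_mul_of_nonneg_right ?_ hw0
      have h7 : t * p ≤ Θ.trace⁻¹ / 2 * √n := by
        calc t * p = Θ.trace⁻¹ / 2 * (t * p * (2 * Θ.trace)) := by field_simp
          _ ≤ _ := by gcongr
      calc t * √n * p = t * p * √n := by ring
        _ ≤ Θ.trace⁻¹ / 2 * √n * √n := by gcongr
        _ = _ := by rw [mul_assoc, hsn]
    have h8 : (n : ℝ) * (Θ.trace⁻¹ * (w ⬝ᵥ w)) ≤ n * (w ⬝ᵥ Θ⁻¹ *ᵥ w) := by gcongr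
    linarith
  · have h1 := (abs_le.1 (hclose.abs_form_sub_le u u)).2
    rw [inv_mulVec_nodeResidual hΘ, dotProduct_single, huj, one_mul] at h1
    have h2 : t * √n * U * U ≤ t * U * U * n := by
      calc t * √n * U * U = t * U * U * √n := by ring
        _ ≤ _ := by
          gcongr
          nlinarith
    linarith
  · have h1 := hclose.abs_form_sub_le d u
    rw [inv_mulVec_nodeResidual hΘ, dotProduct_single, hdj, zero_mul, mul_zero, sub_zero] at h1
    have h2 := sq_sum_abs_le d
    have hd0 : 0 ≤ d ⬝ᵥ d := Finset.sum_nonneg fun k _ => mul_self_nonneg _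
    calc (d ⬝ᵥ S *ᵥ u) ^ 2 = |d ⬝ᵥ S *ᵥ u| ^ 2 := (sq_abs _).symm
      _ ≤ (t * √n * (∑ k, |d k|) * U) ^ 2 := by gcongr
      _ = t ^ 2 * U ^ 2 * n * (∑ k, |d k|) ^ 2 := by
        rw [mul_pow, mul_pow, mul_pow, Real.sq_sqrt (by linarith)]
        ring
      _ ≤ t ^ 2 * U ^ 2 * n * (p * (d ⬝ᵥ d)) := by gcongr
      _ ≤ _ := by nlinarith [mul_nonneg (by linarith : (0 : ℝ) ≤ n) hd0]

variable {c C K : ℝ} {n : ℕ} {j : Fin p} {u : Fin p → ℝ} {A : Finset (Fin p)}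

theorem IsRegular.posDef (h : IsRegular c C K n j u S) (hc : 0 < c) (hn : 0 < n) : S.PosDef := by
  refine .of_dotProduct_mulVec_pos ?_ fun w hw => ?_
  · rw [IsHermitian, conjTranspose_eq_transpose_of_trivial]
    exact h.symm
  · have hn' : (0 : ℝ) < n := by exact_mod_cast hn
    have h1 : 0 < w ⬝ᵥ w := by
      simpa using (dotProduct_star_self_pos_iff (v := w)).2 hw
    have := h.lower w
    rw [star_trivial]
    exact lt_of_lt_of_le (by positivity) this

theorem IsRegular.le_residual (h : IsRegular c C K n j u S) (hc : 0 < c) (hn : 0 < n)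
    (hj : j ∉ A) : c * n ≤ residual S j A := by
  obtain ⟨w, hwj, -, hw⟩ := exists_quadratic_eq_residual (h.posDef hc hn) hj
  rw [hw]
  refine le_trans ?_ (h.lower w)
  have h1 : 1 ≤ w ⬝ᵥ w := by
    have := Finset.single_le_sum (f := fun k => w k * w k) (fun k _ => mul_self_nonneg _)
      (Finset.mem_univ j)
    simpa [hwj, dotProduct] using this
  exact le_mul_of_one_le_right (by positivity) h1

theorem IsRegular.exists_residual_eq (h : IsRegular c C K n j u S) (hc : 0 < c) (hn : 0 < n)
    (hu : u j = 1) (hj : j ∉ A) : ∃ d : Fin p → ℝ, d j = 0 ∧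
      (∀ k, k ∉ insert j A → d k = - u k) ∧
      residual S j A = u ⬝ᵥ S *ᵥ u + 2 * (d ⬝ᵥ S *ᵥ u) + d ⬝ᵥ S *ᵥ d := by
  obtain ⟨w, hwj, hwA, hw⟩ := exists_quadratic_eq_residual (h.posDef hc hn) hj
  refine ⟨w - u, by simp [hwj, hu], fun k hk => by simp [hwA k hk], ?_⟩
  rw [← IsSymm.quadratic_add h.symm, add_sub_cancel, hw]

/-- Any sample minimiser is `u + d` with `d j = 0`. The linear gain is at most of order `√n |d|`
while the quadratic cost is at least of order `n |d|²`; completing the square bounds the net gain by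
a constant. -/
theorem IsRegular.le_residual_add (h : IsRegular c C K n j u S) (hc : 0 < c) (hK : 0 < K)
    (hn : 0 < n) (hu : u j = 1) (hj : j ∉ A) :
    u ⬝ᵥ S *ᵥ u ≤ residual S j A + K / c := by
  obtain ⟨d, hdj, -, hd⟩ := h.exists_residual_eq hc hn hu hj
  have h1 := h.lower d
  have h2 := h.gradient d hdj
  rw [hd]
  set x := d ⬝ᵥ S *ᵥ u
  have h3 : c / K * x ^ 2 ≤ c * n * (d ⬝ᵥ d) := by
    calc c / K * x ^ 2 ≤ c / K * (K * n * (d ⬝ᵥ d)) := by gcongr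
      _ = _ := by field_simp
  have h4 : 0 ≤ c / K * (x + K / c) ^ 2 := by positivity
  have h5 : c / K * (x + K / c) ^ 2 = c / K * x ^ 2 + 2 * x + K / c := by
    field_simp
    ring
  linarith

/-- Omitting `k` forces `d k = -u k`, so `|d|²` is at least `(u k)²` and the quadratic cost is
linear in `n`. The threshold on `n`, with its factor `16`, makes the cross term consume at most half
of that cost. -/
theorem IsRegular.add_le_residual (h : IsRegular c C K n j u S) (hc : 0 < c)
    (hn : 0 < n) (hu : u j = 1) (hj : j ∉ A) {k : Fin p} (hkj : k ≠ j) (hkA : k ∉ A)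
    (hlarge : 16 * K ≤ c ^ 2 * (u k) ^ 2 * n) :
    u ⬝ᵥ S *ᵥ u + c * (u k) ^ 2 / 2 * n ≤ residual S j A := by
  obtain ⟨d, hdj, hdA, hd⟩ := h.exists_residual_eq hc hn hu hj
  have h1 := h.lower d
  have h2 := h.gradient d hdj
  have hy : (u k) ^ 2 ≤ d ⬝ᵥ d := by
    have := Finset.single_le_sum (f := fun l => d l * d l) (fun l _ => mul_self_nonneg _)
      (Finset.mem_univ k)
    simp only [hdA k (by simp [hkj, hkA])] at this
    rw [dotProduct]
    linarith
  have hn' : (0 : ℝ) < n := by exact_mod_cast hn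
  have hy0 : 0 ≤ d ⬝ᵥ d := (sq_nonneg _).trans hy
  rw [hd]
  set x := d ⬝ᵥ S *ᵥ u
  set y := d ⬝ᵥ d
  have h3 : (4 * x) ^ 2 ≤ (c * n * y) ^ 2 := by
    calc (4 * x) ^ 2 = 16 * x ^ 2 := by ring
      _ ≤ 16 * (K * n * y) := by gcongr
      _ = 16 * K * (n * y) := by ring
      _ ≤ c ^ 2 * (u k) ^ 2 * n * (n * y) := by gcongr
      _ ≤ c ^ 2 * y * n * (n * y) := by gcongr
      _ = _ := by ring
  have h4 := (abs_le_of_sq_le_sq' h3 (by positivity)).1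
  have h5 : c * n * (u k) ^ 2 ≤ c * n * y := by gcongr
  linarith

end Deviation

/-! ### Comparison of local scores -/

section Score

variable {p : ℕ} {Θ : Matrix (Fin p) (Fin p) ℝ}

theorem localScore_eq {n : ℕ} (X : Matrix (Fin n) (Fin p) ℝ) (j : Fin p) (A : Finset (Fin p)) :
    localScore X j A = Real.pi ^ (-(((n : ℝ) - 1) / 2)) * (scoreWeight n A.card *
      residual (scatter X) j A ^ (-(((n : ℝ) - 1) / 2))) := by
  rw [localScore, scoreWeight, residual]
  ring

theorem localScore_pos {n : ℕ} (hn : 0 < n) {X : Matrix (Fin n) (Fin p) ℝ} {j : Fin p}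
    {A : Finset (Fin p)} (h : 0 < residual (scatter X) j A) : 0 < localScore X j A := by
  have := scoreWeight_pos hn A.card
  rw [localScore_eq]
  positivity

theorem localScore_lt {n : ℕ} (hn : 0 < n) {X : Matrix (Fin n) (Fin p) ℝ} {j : Fin p}
    {A B : Finset (Fin p)} {q : ℝ} (hq : 0 < q) (hB : 0 < residual (scatter X) j B)
    (hA : 0 < residual (scatter X) j A)
    (hBA : residual (scatter X) j B ≤ q * residual (scatter X) j A)
    (hw : scoreWeight n A.card * q ^ (((n : ℝ) - 1) / 2) < scoreWeight n B.card) :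
    localScore X j A < localScore X j B := by
  have hn' : (1 : ℝ) ≤ n := by exact_mod_cast hn
  have hwA := scoreWeight_pos hn A.card
  rw [localScore_eq, localScore_eq]
  refine mul_lt_mul_of_pos_left ?_ (by positivity)
  set m := ((n : ℝ) - 1) / 2
  set a := residual (scatter X) j A
  set b := residual (scatter X) j B
  have hm : 0 ≤ m := by simp only [m]; linarith
  have h1 : b ^ m ≤ q ^ m * a ^ m := by
    rw [← Real.mul_rpow hq.le hA.le]
    exact Real.rpow_le_rpow hB.le hBA hm
  have ha : 0 < a ^ m := by positivity
  have hb : 0 < b ^ m := by positivity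
  rw [Real.rpow_neg hA.le, Real.rpow_neg hB.le, ← div_eq_mul_inv, ← div_eq_mul_inv,
    div_lt_div_iff₀ ha hb]
  calc scoreWeight n A.card * b ^ m ≤ scoreWeight n A.card * (q ^ m * a ^ m) := by gcongr
    _ = scoreWeight n A.card * q ^ m * a ^ m := by ring
    _ < _ := by gcongr

theorem scatter_isSymm {n : ℕ} (X : Matrix (Fin n) (Fin p) ℝ) : (scatter X).IsSymm := by
  rw [scatter, IsSymm, transpose_mul, transpose_transpose]

theorem eventually_localScore_pos (hΘ : Θ.PosDef) {t : ℝ} (ht : 0 ≤ t) {j : Fin p}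
    {A : Finset (Fin p)} (hA : j ∉ A) :
    ∀ᶠ n : ℕ in atTop, ∀ X : Matrix (Fin n) (Fin p) ℝ, IsClose Θ⁻¹ t n (scatter X) →
      0 < localScore X j A := by
  obtain ⟨c, C, K, hc, -, -, h⟩ := exists_isRegular hΘ t ht j
  filter_upwards [h, eventually_gt_atTop 0] with n h hn X hX
  have hn' : (0 : ℝ) < n := by exact_mod_cast hn
  have := (h _ (scatter_isSymm X) hX).le_residual hc hn hA
  exact localScore_pos hn (lt_of_lt_of_le (by positivity) this)

/-- A proper superset of the true Markov blanket eventually has a smaller local score. -/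
theorem eventually_localScore_lt_of_ssubset (hΘ : Θ.PosDef) {t : ℝ} (ht : 0 ≤ t) {j : Fin p}
    {B A : Finset (Fin p)} (hB : ∀ k, k ≠ j → Θ k j ≠ 0 → k ∈ B) (hA : j ∉ A) (hBA : B ⊂ A) :
    ∀ᶠ n : ℕ in atTop, ∀ X : Matrix (Fin n) (Fin p) ℝ, IsClose Θ⁻¹ t n (scatter X) →
      localScore X j A < localScore X j B := by
  obtain ⟨c, C, K, hc, hC, hK, h⟩ := exists_isRegular hΘ t ht j
  have hjB : j ∉ B := fun hj => hA (hBA.1 hj)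
  -- The excess `K / c` relative to a residual of at least `c n` is `D / n`; raising `1 + D / n` to
  -- the power `(n-1)/2` stays below `exp D`.
  set D := K / c / c
  have hD : 0 < D := by positivity
  filter_upwards [h, eventually_gt_atTop 0,
    eventually_scoreWeight_mul_lt (Finset.card_lt_card hBA) (Real.exp D)] with n h hn hw X hX
  have hn' : (0 : ℝ) < n := by exact_mod_cast hn
  have hreg := h _ (scatter_isSymm X) hX
  have hrA := hreg.le_residual hc hn hA
  have hrB := hreg.le_residual hc hn hjB
  have hcn : 0 < c * n := by positivity
  have h1 := hreg.le_residual_add hc hK hn (nodeResidual_self hΘ j) hA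
  have h2 := residual_le_quadratic (hreg.posDef hc hn) hjB (nodeResidual_self hΘ j)
    (fun k hk => by
      simp only [Finset.mem_insert, not_or] at hk
      have : Θ k j = 0 := by
        by_contra hne
        exact hk.2 (hB k hk.1 hne)
      simp [nodeResidual, this])
  refine localScore_lt hn (q := 1 + D / n) (by positivity) (hcn.trans_le hrB) (hcn.trans_le hrA)
    ?_ (lt_of_le_of_lt ?_ hw)
  · have h3 : K / c ≤ D / n * residual (scatter X) j A := by
      calc K / c = D / n * (c * n) := by
            simp only [D]
            field_simp
        _ ≤ _ := by gcongr
    linarith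
  · have := scoreWeight_pos hn A.card
    have hn1 : (1 : ℝ) ≤ n := by exact_mod_cast hn
    gcongr
    calc (1 + D / n) ^ (((n : ℝ) - 1) / 2) ≤ (Real.exp (D / n)) ^ (((n : ℝ) - 1) / 2) := by
          refine Real.rpow_le_rpow (by positivity) ?_ (by linarith)
          linarith [Real.add_one_le_exp (D / n)]
      _ = Real.exp (D / n * (((n : ℝ) - 1) / 2)) := by rw [← Real.exp_mul]
      _ ≤ Real.exp D := by
          refine Real.exp_le_exp.2 ?_
          rw [div_mul_eq_mul_div, div_le_iff₀ hn']
          gcongr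
          linarith

/-- A set missing an element of the true Markov blanket eventually has a smaller local score. -/
theorem eventually_localScore_lt_of_notMem (hΘ : Θ.PosDef) {t : ℝ} (ht : 0 ≤ t) {j : Fin p}
    {B A : Finset (Fin p)} (hB : ∀ k, k ≠ j → Θ k j ≠ 0 → k ∈ B) (hjB : j ∉ B) (hA : j ∉ A)
    {k : Fin p} (hkj : k ≠ j) (hk : Θ k j ≠ 0) (hkA : k ∉ A) :
    ∀ᶠ n : ℕ in atTop, ∀ X : Matrix (Fin n) (Fin p) ℝ, IsClose Θ⁻¹ t n (scatter X) →
      localScore X j A < localScore X j B := by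
  obtain ⟨c, C, K, hc, hC, hK, h⟩ := exists_isRegular hΘ t ht j
  have hd : 0 < Θ j j := hΘ.diag_pos
  have hu : 0 < (nodeResidual Θ j k) ^ 2 := by
    have : nodeResidual Θ j k ≠ 0 := div_ne_zero hk hd.ne'
    positivity
  set η := c * (nodeResidual Θ j k) ^ 2 / 2
  have hη : 0 < η := by positivity
  have hlarge : ∀ᶠ n : ℕ in atTop, 16 * K ≤ c ^ 2 * (nodeResidual Θ j k) ^ 2 * n :=
    (tendsto_natCast_atTop_atTop.const_mul_atTop (by positivity)).eventually_ge_atTop _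
  filter_upwards [h, eventually_gt_atTop 0, hlarge,
    -- With `Q = uᵀ S u ≤ C n`, the ratio `Q / (Q + η n)` increases in `Q`, so it is at most `C / (C
    -- + η) < 1`.
    eventually_scoreWeight_mul_rpow_lt A.card B.card (q := C / (C + η)) (by positivity)
      ((div_lt_one (by positivity)).2 (by linarith))] with n h hn hlarge hw X hX
  have hn' : (0 : ℝ) < n := by exact_mod_cast hn
  have hreg := h _ (scatter_isSymm X) hX
  have hrA := hreg.le_residual hc hn hA
  have hrB := hreg.le_residual hc hn hjB
  have hcn : 0 < c * n := by positivity
  have h1 : _ + η * n ≤ _ := hreg.add_le_residual hc hn (nodeResidual_self hΘ j) hA hkj hkA hlarge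
  have h2 := residual_le_quadratic (hreg.posDef hc hn) hjB (nodeResidual_self hΘ j)
    (fun k hk => by
      simp only [Finset.mem_insert, not_or] at hk
      have : Θ k j = 0 := by
        by_contra hne
        exact hk.2 (hB k hk.1 hne)
      simp [nodeResidual, this])
  refine localScore_lt hn (by positivity) (hcn.trans_le hrB) (hcn.trans_le hrA) ?_ hw
  refine h2.trans ?_
  rw [div_mul_eq_mul_div, le_div_iff₀ (by positivity)]
  have h3 := hreg.upper
  have h4 := mul_le_mul_of_nonneg_left h1 hC.le
  have h5 := mul_le_mul_of_nonneg_left h3 hη.le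
  linarith

end Score

end Deviations

section Consistency

/-! ### Chebyshev bounds for the scatter matrix -/

section Concentration

/-- Chebyshev's inequality for sums of a function of independent, identically distributed
observations. -/
theorem measure_abs_sum_sub_ge_le {Ω E : Type*} [MeasurableSpace Ω] [MeasurableSpace E]
    {P : Measure Ω} [IsProbabilityMeasure P] {μ : Measure E} {f : E → ℝ} (hf : Measurable f)
    (hf2 : MemLp f 2 μ) {n : ℕ} (hn : 0 < n) {X : Fin n → Ω → E} (hlaw : ∀ i, HasLaw (X i) μ P)
    (hindep : iIndepFun X P) {t : ℝ} (ht : 0 < t) :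
    P {ω | t * √n ≤ |∑ i, f (X i ω) - n * ∫ x, f x ∂μ|} ≤ ENNReal.ofReal (Var[f; μ] / t ^ 2) := by
  have hn' : (0 : ℝ) < n := by exact_mod_cast hn
  have hmem (i : Fin n) : MemLp (f ∘ X i) 2 P := by
    refine MemLp.comp_of_map ?_ (hlaw i).aemeasurable
    rwa [(hlaw i).map_eq]
  have hvar (i : Fin n) : Var[f ∘ X i; P] = Var[f; μ] := by
    rw [← (hlaw i).map_eq, variance_map hf.aemeasurable (hlaw i).aemeasurable]
  have hint (i : Fin n) : ∫ ω, (f ∘ X i) ω ∂P = ∫ x, f x ∂μ :=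
    (hlaw i).integral_comp hf.aestronglyMeasurable
  have hsum : Var[∑ i, f ∘ X i; P] = n * Var[f; μ] := by
    rw [IndepFun.variance_sum (fun i _ => hmem i)
      (fun i _ j _ hij => (hindep.indepFun hij).comp hf hf)]
    simp [hvar]
  have hexp : ∫ ω, (∑ i, f ∘ X i) ω ∂P = n * ∫ x, f x ∂μ := by
    simp only [Finset.sum_apply]
    rw [integral_finsetSum _ fun i _ => (hmem i).integrable (by norm_num), Finset.sum_congr rfl fun i _ => hint i]
    simp
  have h := meas_ge_le_variance_div_sq (memLp_finsetSum' Finset.univ fun i _ => hmem i)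
    (c := t * √n) (by positivity)
  rw [hexp, hsum, mul_pow, Real.sq_sqrt hn'.le, mul_comm (t ^ 2),
    mul_div_mul_left _ _ hn'.ne'] at h
  simpa using h

variable {p : ℕ} {S : Matrix (Fin p) (Fin p) ℝ}

theorem memLp_mul_coord (k l : Fin p) :
    MemLp (fun x : EuclideanSpace ℝ (Fin p) => x k * x l) 2 (multivariateGaussian 0 S) := by
  have hid : HasGaussianLaw (fun x : EuclideanSpace ℝ (Fin p) => x) (multivariateGaussian 0 S) :=
    IsGaussian.hasGaussianLaw_id
  have hk (k : Fin p) : MemLp (fun x : EuclideanSpace ℝ (Fin p) => x k) 4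
      (multivariateGaussian 0 S) :=
    (hid.map_fun (EuclideanSpace.proj k)).memLp (by norm_num)
  have : ENNReal.HolderTriple 4 4 2 := by
    constructor
    rw [← ENNReal.toReal_eq_toReal_iff' (by simp) (by simp),
      ENNReal.toReal_add (by simp) (by simp)]
    norm_num
  exact (hk l).mul' (hk k)

theorem integral_mul_coord (hS : S.PosSemidef) (k l : Fin p) :
    ∫ x : EuclideanSpace ℝ (Fin p), x k * x l ∂(multivariateGaussian 0 S) = S k l := by
  have hid : HasGaussianLaw (fun x : EuclideanSpace ℝ (Fin p) => x) (multivariateGaussian 0 S) :=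
    IsGaussian.hasGaussianLaw_id
  have hk (k : Fin p) : HasGaussianLaw (fun x : EuclideanSpace ℝ (Fin p) => x k)
      (multivariateGaussian 0 S) := hid.map_fun (EuclideanSpace.proj k)
  have hmean (k : Fin p) :
      ∫ x : EuclideanSpace ℝ (Fin p), x k ∂(multivariateGaussian 0 S) = 0 := by
    have := (EuclideanSpace.proj k : EuclideanSpace ℝ (Fin p) →L[ℝ] ℝ).integral_comp_comm
      hid.integrable
    simpa using this
  have h := covariance_eval_multivariateGaussian (μ := 0) hS k l
  rw [covariance_eq_sub (hk k).memLp_two (hk l).memLp_two, hmean, zero_mul, sub_zero] at h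
  exact h

/-- Each entry of `S` is a sum of i.i.d. products with mean the covariance entry; Chebyshev at scale
`t √n` and a union bound over entries give a bound free of `n`. -/
theorem measure_not_isClose_le (hS : S.PosSemidef) {Ω : Type*} [MeasurableSpace Ω]
    {P : Measure Ω} [IsProbabilityMeasure P] {n : ℕ} (hn : 0 < n)
    {X : Fin n → Ω → EuclideanSpace ℝ (Fin p)}
    (hlaw : ∀ i, HasLaw (X i) (multivariateGaussian 0 S) P) (hindep : iIndepFun X P) {t : ℝ}
    (ht : 0 < t) :
    P {ω | ¬ IsClose S t n (scatter (dataMatrix fun i => X i ω))} ≤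
      ∑ k, ∑ l, ENNReal.ofReal
        (Var[fun x : EuclideanSpace ℝ (Fin p) => x k * x l; multivariateGaussian 0 S] / t ^ 2) := by
  have hsub : {ω | ¬ IsClose S t n (scatter (dataMatrix fun i => X i ω))} ⊆
      ⋃ k, ⋃ l, {ω | t * √n ≤ |∑ i, (X i ω k * X i ω l) -
        n * ∫ x : EuclideanSpace ℝ (Fin p), x k * x l ∂(multivariateGaussian 0 S)|} := by
    intro ω hω
    simp only [IsClose, Set.mem_ofPred_eq, not_forall, not_le] at hω
    obtain ⟨k, l, h⟩ := hω
    simp only [Set.mem_iUnion, Set.mem_ofPred_eq, integral_mul_coord hS]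
    refine ⟨k, l, h.le.trans_eq ?_⟩
    simp [scatter, dataMatrix, Matrix.mul_apply]
  refine (measure_mono hsub).trans ((measure_iUnion_fintype_le _ _).trans
    (Finset.sum_le_sum fun k _ => (measure_iUnion_fintype_le _ _).trans
      (Finset.sum_le_sum fun l _ => ?_)))
  exact measure_abs_sum_sub_ge_le (by fun_prop) (memLp_mul_coord k l) hn hlaw hindep ht

end Concentration

/-! ### From local scores to graphs, and passage to the limit -/

section Graph

variable {p : ℕ} {Θ : Matrix (Fin p) (Fin p) ℝ} {G : SimpleGraph (Fin p)}

theorem mem_markovBlanket {G : SimpleGraph (Fin p)} {j k : Fin p} :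
    k ∈ markovBlanket G j ↔ G.Adj j k := by
  simp [markovBlanket]

theorem notMem_markovBlanket_self (G : SimpleGraph (Fin p)) (j : Fin p) :
    j ∉ markovBlanket G j := by
  simp [mem_markovBlanket]

theorem markovBlanket_injective :
    Function.Injective (markovBlanket : SimpleGraph (Fin p) → Fin p → Finset (Fin p)) := by
  intro G H h
  ext j k
  rw [← mem_markovBlanket, ← mem_markovBlanket, h]

/-- A wrong candidate either strictly contains the true blanket or misses one of its elements, the
overfitting and underfitting cases respectively. -/
theorem eventually_localScore_lt (hΘ : Θ.PosDef) (hG : ∀ i j, i ≠ j → (G.Adj i j ↔ Θ i j ≠ 0))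
    {t : ℝ} (ht : 0 ≤ t) {j : Fin p} {A : Finset (Fin p)} (hA : j ∉ A)
    (hne : A ≠ markovBlanket G j) :
    ∀ᶠ n : ℕ in atTop, ∀ X : Matrix (Fin n) (Fin p) ℝ, IsClose Θ⁻¹ t n (scatter X) →
      localScore X j A < localScore X j (markovBlanket G j) := by
  have hB : ∀ k, k ≠ j → Θ k j ≠ 0 → k ∈ markovBlanket G j := fun k hkj hk => by
    rw [mem_markovBlanket, G.adj_comm]
    exact (hG k j hkj).2 hk
  by_cases hsub : markovBlanket G j ⊆ A
  · exact eventually_localScore_lt_of_ssubset hΘ ht hB hA (hsub.ssubset_of_ne hne.symm)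
  · obtain ⟨k, hkB, hkA⟩ := Finset.not_subset.1 hsub
    rw [mem_markovBlanket, G.adj_comm] at hkB
    exact eventually_localScore_lt_of_notMem hΘ ht hB (notMem_markovBlanket_self G j) hA hkB.ne
      ((hG k j hkB.ne).1 hkB) hkA

/-- On the event that the scatter matrix is close to its mean, the true graph is eventually the
unique maximizer of the score. -/
theorem eventually_maximizers_eq (hΘ : Θ.PosDef) (hG : ∀ i j, i ≠ j → (G.Adj i j ↔ Θ i j ≠ 0))
    {t : ℝ} (ht : 0 ≤ t) :
    ∀ᶠ n : ℕ in atTop, ∀ X : Matrix (Fin n) (Fin p) ℝ, IsClose Θ⁻¹ t n (scatter X) →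
      maximizers X = {G} := by
  have h1 : ∀ᶠ n : ℕ in atTop, ∀ (j : Fin p) (A : Finset (Fin p)), j ∉ A →
      A ≠ markovBlanket G j → ∀ X : Matrix (Fin n) (Fin p) ℝ, IsClose Θ⁻¹ t n (scatter X) →
        localScore X j A < localScore X j (markovBlanket G j) := by
    simp only [eventually_all]
    exact fun j A hA hne => eventually_localScore_lt hΘ hG ht hA hne
  have h2 : ∀ᶠ n : ℕ in atTop, ∀ (j : Fin p) (A : Finset (Fin p)), j ∉ A →
      ∀ X : Matrix (Fin n) (Fin p) ℝ, IsClose Θ⁻¹ t n (scatter X) → 0 < localScore X j A := by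
    simp only [eventually_all]
    exact fun j A hA => eventually_localScore_pos hΘ ht hA
  filter_upwards [h1, h2] with n h1 h2 X hX
  -- A different graph has a different blanket at some node. That factor is strictly smaller, no
  -- other is larger, and positivity lets the product inherit strictness.
  have hlt (H : SimpleGraph (Fin p)) (hH : H ≠ G) : score X H < score X G := by
    obtain ⟨j, hj⟩ := Function.ne_iff.1 (markovBlanket_injective.ne hH)
    refine Finset.prod_lt_prod (fun i _ => h2 i _ (notMem_markovBlanket_self H i) X hX)
      (fun i _ => ?_) ⟨j, Finset.mem_univ j, h1 j _ (notMem_markovBlanket_self H j) hj X hX⟩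
    by_cases hi : markovBlanket H i = markovBlanket G i
    · rw [hi]
    · exact (h1 i _ (notMem_markovBlanket_self H i) hi X hX).le
  ext H
  simp only [maximizers, Set.mem_ofPred_eq, Set.mem_singleton_iff]
  constructor
  · intro hmax
    by_contra hne
    exact (hlt H hne).not_ge (hmax G)
  · rintro rfl H'
    by_cases hne : H' = H
    · rw [hne]
    · exact (hlt H' hne).le

theorem tendsto_measure_maximizers_eq (hΘ : Θ.PosDef)
    (hG : ∀ i j, i ≠ j → (G.Adj i j ↔ Θ i j ≠ 0))
    {Ω : ℕ → Type*} [∀ n, MeasurableSpace (Ω n)]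
    (P : ∀ n, Measure (Ω n)) [∀ n, IsProbabilityMeasure (P n)]
    (X : ∀ n, Fin n → Ω n → EuclideanSpace ℝ (Fin p))
    (hlaw : ∀ n i, HasLaw (X n i) (multivariateGaussian 0 Θ⁻¹) (P n))
    (hindep : ∀ n, iIndepFun (X n) (P n)) :
    Tendsto (fun n => P n {ω | maximizers (dataMatrix fun i => X n i ω) = {G}}) atTop (𝓝 1) := by
  have hbound : Tendsto (fun t : ℝ => 1 - ∑ k : Fin p, ∑ l : Fin p, ENNReal.ofReal
      (Var[fun x : EuclideanSpace ℝ (Fin p) => x k * x l; multivariateGaussian 0 Θ⁻¹] / t ^ 2))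
      atTop (𝓝 1) := by
    have h0 (v : ℝ) : Tendsto (fun t : ℝ => ENNReal.ofReal (v / t ^ 2)) atTop (𝓝 0) := by
      rw [← ENNReal.ofReal_zero]
      exact ENNReal.tendsto_ofReal
        (tendsto_const_nhds.div_atTop (tendsto_pow_atTop two_ne_zero))
    have h1 := tendsto_finsetSum (Finset.univ : Finset (Fin p)) fun k _ =>
      tendsto_finsetSum (Finset.univ : Finset (Fin p)) fun l _ =>
        h0 Var[fun x : EuclideanSpace ℝ (Fin p) => x k * x l; multivariateGaussian 0 Θ⁻¹]
    simp only [Finset.sum_const_zero] at h1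
    have h2 := ENNReal.Tendsto.sub (tendsto_const_nhds (x := (1 : ENNReal))) h1
      (Or.inl ENNReal.one_ne_top)
    rwa [tsub_zero] at h2
  refine tendsto_order.2 ⟨fun a ha => ?_, fun a ha =>
    Eventually.of_forall fun n => prob_le_one.trans_lt ha⟩
  -- The radius `t` is fixed before `n`: the failure bound depends on `t` alone, while the threshold
  -- for `n` may depend on `t`.
  obtain ⟨t, hta, ht⟩ := ((hbound.eventually_const_lt ha).and (eventually_gt_atTop 0)).exists
  filter_upwards [eventually_maximizers_eq hΘ hG ht.le, eventually_gt_atTop 0] with n hmax hn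
  refine hta.trans_le ?_
  rw [tsub_le_iff_right]
  calc (1 : ENNReal) = P n Set.univ := measure_univ.symm
    _ ≤ P n ({ω | maximizers (dataMatrix fun i => X n i ω) = {G}} ∪
        {ω | ¬ IsClose Θ⁻¹ t n (scatter (dataMatrix fun i => X n i ω))}) := by
        refine measure_mono fun ω _ => ?_
        by_cases hω : IsClose Θ⁻¹ t n (scatter (dataMatrix fun i => X n i ω))
        · exact Or.inl (hmax _ hω)
        · exact Or.inr hω
    _ ≤ _ := (measure_union_le _ _).trans (by
        gcongr
        exact measure_not_isClose_le hΘ.inv.posSemidef hn (hlaw n) (hindep n) ht)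

end Graph

end Consistency

end FMPL

end

/-- Consistency of the global fractional marginal pseudo-likelihood estimator: for i.i.d. samples of
size `n` from `N_p(0, Θ⁻¹)`, with probability tending to `1` the true graph is the unique maximizer
of the score over all undirected graphs, and hence every maximizer of the score equals it. -/
theorem corollary1 {p : ℕ} (Θ : Matrix (Fin p) (Fin p) ℝ) (hΘ : Θ.PosDef)
    (Gstar : SimpleGraph (Fin p))
    (hG : FMPL.IsCondIndepGraph (multivariateGaussian 0 Θ⁻¹) Gstar)
    {Ω : ℕ → Type*} [∀ n, MeasurableSpace (Ω n)]
    (P : ∀ n, Measure (Ω n)) [∀ n, IsProbabilityMeasure (P n)]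
    (X : ∀ n, Fin n → Ω n → EuclideanSpace ℝ (Fin p))
    (hlaw : ∀ n i, HasLaw (X n i) (multivariateGaussian 0 Θ⁻¹) (P n))
    (hindep : ∀ n, iIndepFun (X n) (P n)) :
    Tendsto
      (fun n => P n {ω | FMPL.maximizers (FMPL.dataMatrix fun i => X n i ω) = {Gstar}})
      atTop (𝓝 1) ∧
    ∀ Ghat : ∀ n, Ω n → SimpleGraph (Fin p),
      (∀ n ω, Ghat n ω ∈ FMPL.maximizers (FMPL.dataMatrix fun i => X n i ω)) →
      Tendsto (fun n => P n {ω | Ghat n ω = Gstar}) atTop (𝓝 1) := by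
  have hmax := FMPL.tendsto_measure_maximizers_eq hΘ (fun i j hij => hG.adj_iff hΘ hij) P X hlaw
    hindep
  refine ⟨hmax, fun Ghat hGhat => ?_⟩
  -- Where the set of maximizers is `{Gstar}`, any selection from it equals `Gstar`; monotonicity of
  -- the measure squeezes the probability between that of this event and `1`.
  refine tendsto_of_tendsto_of_tendsto_of_le_of_le hmax tendsto_const_nhds
    (fun n => measure_mono fun ω hω => ?_) (fun n => prob_le_one)
  have h := hGhat n ω
  rw [show FMPL.maximizers (FMPL.dataMatrix fun i => X n i ω) = {Gstar} from hω] at h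
  exact h
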